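/- **Theorem 3.1.** For a finite graph $G$ and a set $S$ of at least two vertices of $G$, let $\kappa(S)$ be the maximum number $\ell$ of pairwise edge-disjoint trees $T_1,\dots,T_\ell$ in $G$, each containing all vertices of $S$, such that $V(T_i)\cap V(T_j)=S$ for all $i\neq j$. For $2\le k\le |V(G)|$ let $\kappa_k(G)=\min\{\kappa(S): S\subseteq V(G),\ |S|=k\}$ (the generalized $k$-connectivity of $G$). Let $a\le b$ be positive integers, let $K_{a,b}$ be the complete bipartite graph with parts of sizes $a$ and $b$, and let $2\le k\le a+b$. - If $k\le b-a+2$, then $\kappa_k(K_{a,b})=a$. - If $k>b-a+2$ and $a-b+k$ is odd, then $$\kappa_k(K_{a,b})=\frac{a+b-k+1}{2}+\left\lfloor\frac{(a-b+k-1)(b-a+k-1)}{4(k-1)}\right\rfloor.$$ - If $k>b-a+2$ and $a-b+k$ is even, then $$\kappa_k(K_{a,b})=\frac{a+b-k}{2}+\left\lfloor\frac{(a-b+k)(b-a+k)}{4(k-1)}\right\rfloor.$$ -/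

import Mathlib

namespace SimpleGraph

/-- `T 0, …, T (ℓ - 1)` is an internally disjoint family of trees of `G` connecting `S`:
each `T i` is a tree in `G` containing all of `S`, the trees are pairwise edge-disjoint, and any
two of them have exactly the vertices of `S` in common. -/
structure IsInternallyDisjointTrees {V : Type*} (G : SimpleGraph V) (S : Finset V) {ℓ : ℕ}
    (T : Fin ℓ → G.Subgraph) : Prop where
  isTree : ∀ i, (T i).coe.IsTree
  subset_verts : ∀ i, (S : Set V) ⊆ (T i).verts
  edge_disjoint : ∀ i j, i ≠ j → Disjoint (T i).edgeSet (T j).edgeSet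
  inter_verts : ∀ i j, i ≠ j → (T i).verts ∩ (T j).verts = (S : Set V)

/-- `κ(S)`: the maximum number of internally disjoint trees of `G` connecting `S`.
For a finite graph and `2 ≤ #S` the maximum exists, see `isGreatest_treeConnectivity`. -/
noncomputable def treeConnectivity {V : Type*} (G : SimpleGraph V) (S : Finset V) : ℕ :=
  sSup {ℓ : ℕ | ∃ T : Fin ℓ → G.Subgraph, G.IsInternallyDisjointTrees S T}

/-- The (generalized) `k`-connectivity `κ_k(G)`: the minimum of `κ(S)` over the `k`-element sets
`S` of vertices. For `k` at most the number of vertices there is such a set, and the infimum is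
a minimum, see `isLeast_generalizedConnectivity`. -/
noncomputable def generalizedConnectivity {V : Type*} (G : SimpleGraph V) (k : ℕ) : ℕ :=
  sInf {m : ℕ | ∃ S : Finset V, S.card = k ∧ G.treeConnectivity S = m}

theorem isGreatest_treeConnectivity {V : Type*} [Finite V] (G : SimpleGraph V) (S : Finset V)
    (hS : 2 ≤ S.card) :
    IsGreatest {ℓ : ℕ | ∃ T : Fin ℓ → G.Subgraph, G.IsInternallyDisjointTrees S T}
      (G.treeConnectivity S) := by
  have hb : BddAbove {ℓ : ℕ | ∃ T : Fin ℓ → G.Subgraph, G.IsInternallyDisjointTrees S T} := by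
    refine ⟨Nat.card (Sym2 V), ?_⟩
    rintro ℓ ⟨T, hT⟩
    have hne : ∀ i, ∃ e, e ∈ (T i).edgeSet := by
      intro i
      obtain ⟨u, hu, v, hv, huv⟩ := Finset.one_lt_card.mp hS
      have hc := (hT.isTree i).connected.preconnected
      have : Nontrivial (T i).verts :=
        ⟨⟨u, hT.subset_verts i hu⟩, ⟨v, hT.subset_verts i hv⟩, fun h => huv (congrArg Subtype.val h)⟩
      obtain ⟨w, hw⟩ := hc.exists_adj_of_nontrivial ⟨u, hT.subset_verts i hu⟩
      exact ⟨s(u, (w : V)), hw⟩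
    choose e he using hne
    have hinj : Function.Injective e := by
      intro i j hij
      by_contra hne
      exact Set.disjoint_left.mp (hT.edge_disjoint i j hne) (he i) (hij ▸ he j)
    simpa using Nat.card_le_card_of_injective e hinj
  refine ⟨Nat.sSup_mem ⟨0, fun i => i.elim0, ?_⟩ hb, fun ℓ hℓ => le_csSup hb hℓ⟩
  exact ⟨fun i => i.elim0, fun i => i.elim0, fun i => i.elim0, fun i => i.elim0⟩

theorem isLeast_generalizedConnectivity {V : Type*} [Fintype V] (G : SimpleGraph V) (k : ℕ)
    (hk : k ≤ Fintype.card V) :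
    IsLeast {m : ℕ | ∃ S : Finset V, S.card = k ∧ G.treeConnectivity S = m}
      (G.generalizedConnectivity k) := by
  obtain ⟨S, -, hS⟩ := Finset.exists_subset_card_eq (s := Finset.univ) hk
  exact ⟨Nat.sInf_mem ⟨_, S, hS, rfl⟩, fun m hm => Nat.sInf_le hm⟩

end SimpleGraph

/-!
Let `S` have `x` vertices in the part of size `a` and `y` in the part of size `b`, and let
`d = (a - x) - (b - y)`. A tree that leaves `S` on both sides needs no edge between the two sides of
`S`, one that leaves `S` on the left (right) only needs at least `x` (`y`) such edges, and one within
`S` needs `k - 1` of them. There are `x y` such edges and `a - x`, `b - y` outer vertices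
(`exists_treeConnectivity_eq_completeBipartiteGraph`). Optimizing gives
`κ(S) ≤ a - x + ⌊x (b - a + x) / (k - 1)⌋` when `y ≥ 1`
(`treeConnectivity_completeBipartiteGraph_le`).

If `d ≥ 0`, this is attained: match the outer vertices of the right with outer ones of the left, use
the other `d` outer vertices on the left for one tree each, and pack as many spanning trees of `S`
as possible, leaving at least `d` edges at each left vertex of `S`. That this packing is limited
only by the number of edges is the cyclic interval construction of `exists_edge_packing`. The case
`d < 0` is symmetric, with value `a` if `-d ≥ x`.

Before rounding, the value is a quadratic polynomial in `x`, whose minimum over the integers is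
attained at `x = (k - 1 + a - b) / 2` or `x = (k + a - b) / 2`, according to parity; in the case
`d < 0` one gets the same polynomial at `y - (b - a)`. If `k ≤ b - a + 2`, the minimum over `x ≥ 0`
is attained at `x = 0` and equals `a`.
-/

/-! ### Connected families and spanning trees -/

namespace SimpleGraph

/-- A nonempty subgraph is connected as soon as every predicate on the ambient vertices that is
constant along its edges is constant on its vertices. -/
theorem Subgraph.connected_of_forall_pred {V : Type*} {G : SimpleGraph V} {H : G.Subgraph}
    (hne : H.verts.Nonempty)
    (h : ∀ P : V → Prop, (∀ u v, H.Adj u v → (P u ↔ P v)) →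
      ∀ u ∈ H.verts, ∀ v ∈ H.verts, P u → P v) : H.Connected := by
  rw [Subgraph.connected_iff]
  refine ⟨⟨?_⟩, hne⟩
  rintro ⟨u, hu⟩ ⟨v, hv⟩
  have key := h (fun w => ∃ hw : w ∈ H.verts, H.coe.Reachable ⟨u, hu⟩ ⟨w, hw⟩) ?_ u hu v hv
    ⟨hu, Reachable.refl _⟩
  · exact key.2
  · intro w z hwz
    have hw := H.edge_vert hwz
    have hz := H.edge_vert hwz.symm
    have hadj : H.coe.Adj ⟨w, hw⟩ ⟨z, hz⟩ := hwz
    exact ⟨fun ⟨_, hr⟩ => ⟨hz, hr.trans hadj.reachable⟩,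
      fun ⟨_, hr⟩ => ⟨hw, hr.trans hadj.symm.reachable⟩⟩

theorem Subgraph.Connected.pred_of_mem {V : Type*} {G : SimpleGraph V} {H : G.Subgraph}
    (hH : H.Connected) {P : V → Prop} (hP : ∀ u v, H.Adj u v → (P u ↔ P v)) {u v : V}
    (hu : u ∈ H.verts) (hv : v ∈ H.verts) (h : P u) : P v := by
  obtain ⟨p⟩ := hH.preconnected.coe ⟨u, hu⟩ ⟨v, hv⟩
  have : ∀ (w z : H.verts), H.coe.Walk w z → P w → P z := by
    intro w z q
    induction q with
    | nil => exact id
    | cons hadj _ ih => exact fun hw => ih ((hP _ _ hadj).1 hw)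
  exact this _ _ p h

theorem Subgraph.Connected.exists_spanning_tree {V : Type*} {G : SimpleGraph V} {H : G.Subgraph}
    (hH : H.Connected) : ∃ T : G.Subgraph, T ≤ H ∧ T.verts = H.verts ∧ T.coe.IsTree := by
  obtain ⟨F, hF, hT⟩ := Connected.exists_isTree_le (G := H.coe) hH.coe
  let T : G.Subgraph :=
    { verts := H.verts
      Adj := fun u v => ∃ (hu : u ∈ H.verts) (hv : v ∈ H.verts), F.Adj ⟨u, hu⟩ ⟨v, hv⟩
      adj_sub := fun ⟨_, _, h⟩ => H.adj_sub (hF h)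
      edge_vert := fun ⟨hu, _, _⟩ => hu
      symm := ⟨fun _ _ ⟨hu, hv, h⟩ => ⟨hv, hu, h.symm⟩⟩ }
  refine ⟨T, ⟨le_rfl, fun u v ⟨_, _, h⟩ => hF h⟩, rfl, ?_⟩
  have : T.coe = F := by
    ext ⟨u, hu⟩ ⟨v, hv⟩
    exact ⟨fun ⟨_, _, h⟩ => h, fun h => ⟨hu, hv, h⟩⟩
  rw [this]
  exact hT

/-- For a lower bound on `κ(S)`, connected subgraphs serve as well as trees: pass to spanning
trees. -/
theorem le_treeConnectivity_of_connected {V : Type*} [Finite V] {G : SimpleGraph V} {S : Finset V}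
    (hS : 2 ≤ S.card) {ℓ : ℕ} (H : Fin ℓ → G.Subgraph) (hc : ∀ i, (H i).Connected)
    (hs : ∀ i, (S : Set V) ⊆ (H i).verts)
    (hd : ∀ i j u v, (H i).Adj u v → (H j).Adj u v → i = j)
    (hi : ∀ i j, i ≠ j → (H i).verts ∩ (H j).verts ⊆ S) : ℓ ≤ G.treeConnectivity S := by
  choose T hle hv hT using fun i => (hc i).exists_spanning_tree
  refine (isGreatest_treeConnectivity G S hS).2 ⟨T, hT, fun i => (hv i) ▸ hs i, ?_, ?_⟩
  · intro i j hij
    rw [Set.disjoint_left]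
    intro e
    induction e with
    | _ u v => exact fun h1 h2 => hij (hd i j u v ((hle i).2 h1) ((hle j).2 h2))
  · intro i j hij
    rw [hv, hv]
    exact (hi i j hij).antisymm (Set.subset_inter (hs i) (hs j))

theorem treeConnectivity_le_map {V W : Type*} [Finite V] [Finite W] {G : SimpleGraph V}
    {G' : SimpleGraph W} (e : G ≃g G') (S : Finset V) (hS : 2 ≤ S.card) :
    G.treeConnectivity S ≤ G'.treeConnectivity (S.map e.toEquiv.toEmbedding) := by
  obtain ⟨T, hT⟩ := (isGreatest_treeConnectivity G S hS).1
  refine le_treeConnectivity_of_connected (by simpa using hS) (fun i => (T i).map e.toHom)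
    ?_ ?_ ?_ ?_
  · intro i
    have hc : (T i).Connected := ⟨(hT.isTree i).connected⟩
    refine Subgraph.connected_of_forall_pred (hc.nonempty.image _) ?_
    rintro P hP _ ⟨u, hu, rfl⟩ _ ⟨v, hv, rfl⟩ h
    exact hc.pred_of_mem (P := fun w => P (e.toHom w))
      (fun w z hwz => hP _ _ ⟨w, z, hwz, rfl, rfl⟩) hu hv h
  · intro i w hw
    simp only [Finset.coe_map, Set.mem_image] at hw
    obtain ⟨v, hv, rfl⟩ := hw
    exact ⟨v, hT.subset_verts i hv, rfl⟩
  · rintro i j _ _ ⟨u, v, h, rfl, rfl⟩ ⟨u', v', h', hu, hv⟩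
    obtain rfl := e.injective hu
    obtain rfl := e.injective hv
    by_contra hij
    exact (Set.disjoint_left.1 (hT.edge_disjoint i j hij)) (Subgraph.mem_edgeSet.2 h)
      (Subgraph.mem_edgeSet.2 h')
  · rintro i j hij _ ⟨⟨u, hu, rfl⟩, ⟨v, hv, huv⟩⟩
    obtain rfl := e.injective huv
    have : v ∈ (S : Set V) := hT.inter_verts i j hij ▸ ⟨hu, hv⟩
    simpa using this

end SimpleGraph

/-! ### Packing edge sets in a complete bipartite graph -/

/-- If `t * (x + y - 1) ≤ x * (y - n)`, the complete bipartite graph on `{0, …, x - 1}` and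
`{0, …, y - 1}` has `n + t` edge-disjoint sets of edges `R 0, R 1, …` such that the first `n` cover
each vertex of the first side and the last `t` are connected and spanning. Connectedness is
expressed by: a pair of predicates which agree along the edges agree everywhere.

In the `j`-th spanning set the vertex `i` is joined to the residues modulo `y` of `j + u`,
`E (i + j) ≤ u ≤ E (i + j + 1)`, where `E l = ⌊l (y - 1) / x⌋`: consecutive vertices `i` share an
end of their intervals, and for fixed `i` the intervals of consecutive `j` are adjacent. -/
theorem exists_edge_packing (x y n t : ℕ) (hxy : 2 ≤ x + y) (hn : n ≤ y)
    (h : t * (x + y - 1) ≤ x * (y - n)) :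
    ∃ R : ℕ → ℕ → ℕ → Prop,
      (∀ τ τ' i v, i < x → R τ i v → R τ' i v → τ = τ') ∧
      (∀ τ < n, ∀ i < x, ∃ v < y, R τ i v) ∧
      (∀ j < t, ∀ P Q : ℕ → Prop, (∀ i < x, ∀ v < y, R (n + j) i v → (P i ↔ Q v)) →
        ∀ i < x, ∀ v < y, (P i ↔ Q v)) := by
  rcases Nat.eq_zero_or_pos x with rfl | hx
  · exact ⟨fun _ _ _ => False, by simp, by simp, by simp⟩
  rcases Nat.eq_zero_or_pos y with rfl | hy
  · obtain rfl : n = 0 := by omega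
    exact ⟨fun _ _ _ => False, by simp, by simp, by simp⟩
  obtain ⟨z, rfl⟩ : ∃ z, y = z + 1 := ⟨y - 1, by omega⟩
  obtain ⟨m, hm⟩ : ∃ m, m + n = z + 1 := ⟨z + 1 - n, by omega⟩
  have h' : t * z + t * x ≤ x * m := by
    have e1 : x + (z + 1) - 1 = z + x := by omega
    have e2 : z + 1 - n = m := by omega
    rw [e1, e2] at h
    linarith
  let E : ℕ → ℕ := fun l => l * z / x
  have hEmono : Monotone E := fun l l' hl => Nat.div_le_div_right (Nat.mul_le_mul_right z hl)
  have hEx : ∀ l, E (l + x) = E l + z := fun l => by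
    simp only [E]
    rw [Nat.add_mul, Nat.add_mul_div_left _ _ hx]
  -- the intervals of a fixed vertex over all spanning sets cover at most `m` positions
  have hEt : ∀ i, E (i + t) + t ≤ E i + m := fun i => by
    have htm : t ≤ m := by
      have : x * t ≤ x * m := by nlinarith
      exact Nat.le_of_mul_le_mul_left this hx
    obtain ⟨r, rfl⟩ := Nat.exists_eq_add_of_le htm
    have : t * z ≤ x * r := by nlinarith
    have h2 : E (i + t) ≤ E i + r := by
      simp only [E]
      rw [← Nat.add_mul_div_left _ _ hx]
      exact Nat.div_le_div_right (by nlinarith)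
    omega
  let pos : ℕ → ℕ → ℕ → Prop := fun τ i w =>
    (τ < n ∧ w = E i + m + τ) ∨
      (n ≤ τ ∧ τ < n + t ∧ ∃ u, w = (τ - n) + u ∧ E (i + (τ - n)) ≤ u ∧ u ≤ E (i + (τ - n) + 1))
  have hbound : ∀ τ i w, pos τ i w → E i ≤ w ∧ w < E i + (z + 1) := by
    rintro τ i w (⟨h1, rfl⟩ | ⟨h1, h2, u, rfl, h3, h4⟩)
    · omega
    · have a1 := hEmono (show i ≤ i + (τ - n) by omega)
      have a2 := hEmono (show i + (τ - n) + 1 ≤ i + t by omega)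
      have a3 := hEt i
      omega
  -- the covers lie beyond the spanning sets, whose intervals increase with `j`
  have hinj : ∀ τ τ' i w, pos τ i w → pos τ' i w → τ = τ' := by
    rintro τ τ' i w (⟨h1, rfl⟩ | ⟨h1, h2, u, rfl, h3, h4⟩)
      (⟨h1', e⟩ | ⟨h1', h2', u', e, h3', h4'⟩)
    · omega
    · have a2 := hEmono (show i + (τ' - n) + 1 ≤ i + t by omega)
      have a3 := hEt i
      omega
    · have a2 := hEmono (show i + (τ - n) + 1 ≤ i + t by omega)
      have a3 := hEt i
      omega
    · rcases lt_trichotomy τ τ' with hlt | rfl | hlt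
      · have := hEmono (show i + (τ - n) + 1 ≤ i + (τ' - n) by omega)
        omega
      · rfl
      · have := hEmono (show i + (τ' - n) + 1 ≤ i + (τ - n) by omega)
        omega
  refine ⟨fun τ i v => ∃ w, pos τ i w ∧ v = w % (z + 1), ?_, ?_, ?_⟩
  · rintro τ τ' i v - ⟨w, hw, rfl⟩ ⟨w', hw', e⟩
    obtain ⟨b1, b2⟩ := hbound _ _ _ hw
    obtain ⟨b1', b2'⟩ := hbound _ _ _ hw'
    have : w = w' := by
      have hmod : w ≡ w' [MOD (z + 1)] := e
      rcases le_total w w' with hle | hle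
      · have := (Nat.modEq_iff_dvd' hle).1 hmod
        have := Nat.eq_zero_of_dvd_of_lt this (by omega)
        omega
      · have := (Nat.modEq_iff_dvd' hle).1 hmod.symm
        have := Nat.eq_zero_of_dvd_of_lt this (by omega)
        omega
    subst this
    exact hinj _ _ _ _ hw hw'
  · intro τ hτ i _
    exact ⟨_, Nat.mod_lt _ (by omega), _, Or.inl ⟨hτ, rfl⟩, rfl⟩
  · intro j hj P Q hPQ
    have hstep : ∀ i < x, ∀ u, E (i + j) ≤ u → u ≤ E (i + j + 1) →
        (P i ↔ Q ((j + u) % (z + 1))) := by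
      intro i hi u h1 h2
      refine hPQ i hi _ (Nat.mod_lt _ (by omega))
        ⟨j + u, Or.inr ⟨by omega, by omega, u, ?_, ?_, ?_⟩, rfl⟩ <;> simp [h1, h2]
    have hall : ∀ i ≤ x, ∀ u, E j ≤ u → u ≤ E (i + j) →
        (Q ((j + u) % (z + 1)) ↔ Q ((j + E j) % (z + 1))) := by
      intro i
      induction i with
      | zero =>
        intro _ u h1 h2
        rw [Nat.zero_add] at h2
        rw [le_antisymm h2 h1]
      | succ i ih =>
        intro hi u h1 h2
        rcases le_total u (E (i + j)) with hu | hu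
        · exact ih (by omega) u h1 hu
        · rw [show i + 1 + j = i + j + 1 by omega] at h2
          rw [← hstep i hi u hu h2, hstep i hi _ le_rfl (hu.trans h2)]
          exact ih (by omega) _ (hEmono (by omega)) le_rfl
    intro i hi v hv
    -- `v` is the residue of `j + u` for some `u` in `[E j, E j + z]`
    obtain ⟨u, hu1, hu2, rfl⟩ : ∃ u, E j ≤ u ∧ u ≤ E j + z ∧ v = (j + u) % (z + 1) := by
      set c := j + E j with hc
      have hcd := Nat.div_add_mod c (z + 1)
      have hcm := Nat.mod_lt c (show 0 < z + 1 by omega)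
      set q := c / (z + 1)
      rcases le_or_gt (c % (z + 1)) v with hle | hlt
      · refine ⟨(z + 1) * q + v - j, by omega, by omega, ?_⟩
        rw [show j + ((z + 1) * q + v - j) = v + (z + 1) * q by omega, Nat.add_mul_mod_self_left,
          Nat.mod_eq_of_lt hv]
      · refine ⟨(z + 1) * q + v + (z + 1) - j, by omega, by omega, ?_⟩
        rw [show j + ((z + 1) * q + v + (z + 1) - j) = v + (z + 1) + (z + 1) * q by omega,
          Nat.add_mul_mod_self_left, Nat.add_mod_right, Nat.mod_eq_of_lt hv]
    rw [hall x le_rfl u hu1 (by rw [Nat.add_comm x j, hEx]; exact hu2),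
      hstep i hi _ le_rfl (hEmono (by omega)), hall i hi.le _ (hEmono (by omega)) le_rfl]

/-! ### Lower bound for a given vertex set -/

/-- An enumeration of a finite type by `0, 1, …` in which the elements of `s` come first. -/
theorem Finset.exists_rank {α : Type*} [Fintype α] (s : Finset α) :
    ∃ r : α → ℕ, Function.Injective r ∧ (∀ a, r a < s.card ↔ a ∈ s) ∧
      ∀ i < Fintype.card α, ∃ a, r a = i := by
  classical
  let r : α → ℕ := fun a =>
    if h : a ∈ s then (s.equivFin ⟨a, h⟩ : ℕ)
    else s.card + (sᶜ.equivFin ⟨a, Finset.mem_compl.2 h⟩ : ℕ)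
  have hr1 : ∀ a (h : a ∈ s), r a = (s.equivFin ⟨a, h⟩ : ℕ) := fun a h => dif_pos h
  have hr2 : ∀ a (h : a ∉ s), r a = s.card + (sᶜ.equivFin ⟨a, Finset.mem_compl.2 h⟩ : ℕ) :=
    fun a h => dif_neg h
  refine ⟨r, ?_, ?_, ?_⟩
  · intro a b hab
    by_cases ha : a ∈ s <;> by_cases hb : b ∈ s
    · rw [hr1 a ha, hr1 b hb] at hab
      simpa using s.equivFin.injective (Fin.ext hab)
    · rw [hr1 a ha, hr2 b hb] at hab
      have := (s.equivFin ⟨a, ha⟩).2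
      omega
    · rw [hr2 a ha, hr1 b hb] at hab
      have := (s.equivFin ⟨b, hb⟩).2
      omega
    · rw [hr2 a ha, hr2 b hb] at hab
      simpa using sᶜ.equivFin.injective (Fin.ext (Nat.add_left_cancel hab))
  · intro a
    by_cases ha : a ∈ s
    · simp [hr1 a ha, ha]
    · simp [hr2 a ha, ha]
  · intro i hi
    by_cases his : i < s.card
    · refine ⟨s.equivFin.symm ⟨i, his⟩, ?_⟩
      rw [hr1 _ (s.equivFin.symm ⟨i, his⟩).2]
      simp
    · have hc : i - s.card < sᶜ.card := by rw [Finset.card_compl]; omega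
      have hm := (sᶜ.equivFin.symm ⟨i - s.card, hc⟩).2
      refine ⟨sᶜ.equivFin.symm ⟨i - s.card, hc⟩, ?_⟩
      rw [hr2 _ (Finset.mem_compl.1 hm)]
      simp
      omega

namespace SimpleGraph

/-- The subgraph of a complete bipartite graph with vertex set `U ∪ W` and edge set `R`. -/
def bipartiteSubgraph {α β : Type*} (U : α → Prop) (W : β → Prop) (R : α → β → Prop)
    (hU : ∀ p q, R p q → U p) (hW : ∀ p q, R p q → W q) :
    (completeBipartiteGraph α β).Subgraph where
  verts := {z | Sum.elim U W z}
  Adj z w := Sum.elim (fun p => Sum.elim (fun _ => False) (fun q => R p q) w)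
    (fun q => Sum.elim (fun p => R p q) (fun _ => False) w) z
  adj_sub := by rintro (p | q) (p' | q') <;> simp
  edge_vert := by
    rintro (p | q) (p' | q') h
    · exact h.elim
    · exact hU _ _ h
    · exact hW _ _ h
    · exact h.elim
  symm := ⟨by rintro (p | q) (p' | q') h <;> exact h⟩

/-- `n₀` trees which use a vertex outside `S` on either side, `n₁` trees which use one on the left
only, and `t` trees within `S`. The number of left vertices of `S` is `x`, of right ones `y`. -/
theorem le_treeConnectivity_completeBipartiteGraph {α β : Type*} [Fintype α] [Fintype β]
    (S : Finset (α ⊕ β)) (hS : 2 ≤ S.card) {x y n₀ n₁ t : ℕ} (hx : S.toLeft.card = x)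
    (hy : S.toRight.card = y) (hα : n₀ + n₁ + x ≤ Fintype.card α) (hβ : n₀ + y ≤ Fintype.card β)
    (hn : n₁ ≤ y) (ht : t * (x + y - 1) ≤ x * (y - n₁)) :
    n₀ + n₁ + t ≤ (completeBipartiteGraph α β).treeConnectivity S := by
  have hxy : x + y = S.card := by rw [← hx, ← hy, Finset.card_toLeft_add_card_toRight]
  obtain ⟨r, hr, hrS, hrs⟩ := Finset.exists_rank S.toLeft
  obtain ⟨c, hc, hcS, hcs⟩ := Finset.exists_rank S.toRight
  rw [hx] at hrS
  rw [hy] at hcS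
  simp only [Finset.mem_toLeft, Finset.mem_toRight] at hrS hcS
  obtain ⟨R, hR1, hR2, hR3⟩ := exists_edge_packing x y n₁ t (by omega) hn ht
  -- in terms of ranks, the outer vertices of the tree `τ` are `x + τ` and `y + τ`
  let U : ℕ → ℕ → Prop := fun τ i => i < x ∨ (τ < n₀ + n₁ ∧ i = x + τ)
  let W : ℕ → ℕ → Prop := fun τ v => v < y ∨ (τ < n₀ ∧ v = y + τ)
  let Q : ℕ → ℕ → ℕ → Prop := fun τ i v =>
    (τ < n₀ + n₁ ∧ i = x + τ ∧ W τ v) ∨ (τ < n₀ ∧ i < x ∧ v = y + τ) ∨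
      (n₀ ≤ τ ∧ i < x ∧ v < y ∧ R (τ - n₀) i v)
  have hQU : ∀ τ i v, Q τ i v → U τ i := by
    rintro τ i v (⟨h1, h2, -⟩ | ⟨-, h, -⟩ | ⟨-, h, -⟩)
    exacts [Or.inr ⟨h1, h2⟩, Or.inl h, Or.inl h]
  have hQW : ∀ τ i v, Q τ i v → W τ v := by
    rintro τ i v (⟨-, -, h⟩ | ⟨h1, -, h2⟩ | ⟨-, -, h, -⟩)
    exacts [h, Or.inr ⟨h1, h2⟩, Or.inl h]
  let H : Fin (n₀ + n₁ + t) → (completeBipartiteGraph α β).Subgraph := fun τ =>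
    bipartiteSubgraph (fun p => U τ (r p)) (fun q => W τ (c q)) (fun p q => Q τ (r p) (c q))
      (fun p q => hQU _ _ _) (fun p q => hQW _ _ _)
  have hHS : ∀ τ, (S : Set (α ⊕ β)) ⊆ (H τ).verts := by
    rintro τ (p | q) h
    · exact Or.inl ((hrS p).2 h)
    · exact Or.inl ((hcS q).2 h)
  refine le_treeConnectivity_of_connected hS H ?_ hHS ?_ ?_
  · rintro ⟨τ, hτ⟩
    refine Subgraph.connected_of_forall_pred ?_ ?_
    · obtain ⟨z, hz⟩ : S.Nonempty := Finset.card_pos.1 (by omega)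
      exact ⟨z, hHS _ hz⟩
    intro P hP
    have hP' : ∀ p q, Q τ (r p) (c q) → (P (.inl p) ↔ P (.inr q)) :=
      fun p q h => hP (.inl p) (.inr q) h
    -- a tree with an outer left vertex is treated by showing `P` agrees with that vertex
    have outer : ∀ p₀, τ < n₀ + n₁ → r p₀ = x + τ →
        ∀ z ∈ (H ⟨τ, hτ⟩).verts, (P z ↔ P (.inl p₀)) := by
      intro p₀ h0 hp0
      have hq : ∀ q, W τ (c q) → (P (.inr q) ↔ P (.inl p₀)) := fun q hq =>
        (hP' p₀ q (Or.inl ⟨h0, hp0, hq⟩)).symm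
      rintro (p | q) hz
      · rcases hz with hp | ⟨-, hp⟩
        · rcases lt_or_ge τ n₀ with h1 | h1
          · obtain ⟨q, hcq⟩ := hcs (y + τ) (by omega)
            exact (hP' p q (Or.inr (Or.inl ⟨h1, hp, hcq⟩))).trans (hq q (Or.inr ⟨h1, hcq⟩))
          · obtain ⟨v, hv, hRv⟩ := hR2 (τ - n₀) (by omega) (r p) hp
            obtain ⟨q, rfl⟩ := hcs v (by omega)
            exact (hP' p q (Or.inr (Or.inr ⟨h1, hp, hv, hRv⟩))).trans (hq q (Or.inl hv))
        · rw [hr (hp.trans hp0.symm)]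
      · exact hq q hz
    rcases lt_or_ge τ (n₀ + n₁) with h0 | h0
    · obtain ⟨p₀, hp₀⟩ := hrs (x + τ) (by omega)
      intro u hu v hv h
      exact (outer p₀ h0 hp₀ v hv).2 ((outer p₀ h0 hp₀ u hu).1 h)
    · have key := hR3 (τ - (n₀ + n₁)) (by omega) (fun i => ∃ p, r p = i ∧ P (.inl p))
        (fun v => ∃ q, c q = v ∧ P (.inr q)) ?_
      · have hlr : ∀ p q, r p < x → c q < y → (P (.inl p) ↔ P (.inr q)) := by
          intro p q hp hq
          have := key _ hp _ hq
          simpa [hr.eq_iff, hc.eq_iff] using this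
        have hU : ∀ p, Sum.inl p ∈ (H ⟨τ, hτ⟩).verts → r p < x := by
          rintro p (h | ⟨h, -⟩)
          · exact h
          · exact absurd h h0.not_gt
        have hW : ∀ q, Sum.inr q ∈ (H ⟨τ, hτ⟩).verts → c q < y := by
          rintro q (h | ⟨h, -⟩)
          · exact h
          · exact absurd h (show ¬ τ < n₀ by omega)
        -- there are vertices on both sides, since the tree has edges
        have hpos : 0 < x ∧ 0 < y := by
          have h1 : 0 < t := by omega
          have : 0 < t * (x + y - 1) := Nat.mul_pos h1 (by omega)
          have h2 : 0 < x * (y - n₁) := by omega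
          have := Nat.pos_of_mul_pos_right h2
          have := Nat.pos_of_mul_pos_left h2
          omega
        obtain ⟨p₀, hp₀⟩ := hrs 0 (by omega)
        obtain ⟨q₀, hq₀⟩ := hcs 0 (by omega)
        have hall : ∀ z ∈ (H ⟨τ, hτ⟩).verts, (P z ↔ P (.inl p₀)) := by
          rintro (p | q) hz
          · exact (hlr p q₀ (hU p hz) (by omega)).trans (hlr p₀ q₀ (by omega) (by omega)).symm
          · exact (hlr p₀ q (by omega) (hW q hz)).symm
        intro u hu v hv h
        exact (hall v hv).2 ((hall u hu).1 h)
      · intro i hi v hv hRiv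
        obtain ⟨p, rfl⟩ := hrs i (by omega)
        obtain ⟨q, rfl⟩ := hcs v (by omega)
        have := hP' p q (Or.inr (Or.inr ⟨by omega, hi, hv, by
          rwa [show τ - n₀ = n₁ + (τ - (n₀ + n₁)) by omega]⟩))
        simpa [hr.eq_iff, hc.eq_iff] using this
  · have hQ : ∀ τ τ' i v, Q τ i v → Q τ' i v → τ = τ' := by
      rintro τ τ' i v (⟨h1, h2, h3⟩ | ⟨h1, h2, h3⟩ | ⟨h1, h2, h3, h4⟩)
        (⟨h1', h2', h3'⟩ | ⟨h1', h2', h3'⟩ | ⟨h1', h2', h3', h4'⟩)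
      case inr.inr.inr.inr =>
        have := hR1 _ _ _ _ h2 h4 h4'
        omega
      all_goals omega
    rintro τ τ' (p | q) (p' | q') h h'
    · exact h.elim
    · exact Fin.ext (hQ _ _ _ _ h h')
    · exact Fin.ext (hQ _ _ _ _ h h')
    · exact h.elim
  · rintro τ τ' hne (p | q) ⟨h1, h2⟩
    · refine (hrS p).1 ?_
      rcases h1 with h1 | ⟨-, h1⟩
      · exact h1
      rcases h2 with h2 | ⟨-, h2⟩
      · exact h2
      exact (hne (Fin.ext (by omega))).elim
    · refine (hcS q).1 ?_
      rcases h1 with h1 | ⟨-, h1⟩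
      · exact h1
      rcases h2 with h2 | ⟨-, h2⟩
      · exact h2
      exact (hne (Fin.ext (by omega))).elim

/-- The symmetric statement, with `n₂` trees which leave `S` on the right only. -/
theorem le_treeConnectivity_completeBipartiteGraph' {α β : Type*} [Fintype α] [Fintype β]
    (S : Finset (α ⊕ β)) (hS : 2 ≤ S.card) {x y n₀ n₂ t : ℕ} (hx : S.toLeft.card = x)
    (hy : S.toRight.card = y) (hα : n₀ + x ≤ Fintype.card α)
    (hβ : n₀ + n₂ + y ≤ Fintype.card β) (hn : n₂ ≤ x)
    (ht : t * (x + y - 1) ≤ y * (x - n₂)) :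
    n₀ + n₂ + t ≤ (completeBipartiteGraph α β).treeConnectivity S := by
  have h1 := le_treeConnectivity_completeBipartiteGraph (S.map (Equiv.sumComm α β).toEmbedding)
    (by simpa using hS) (x := y) (y := x) (n₀ := n₀) (n₁ := n₂) (t := t)
    (by simpa using hy) (by simpa using hx) hβ hα hn (by rwa [Nat.add_comm y x])
  let f : completeBipartiteGraph β α ≃g completeBipartiteGraph α β :=
    ⟨Equiv.sumComm β α, by intro z w; rcases z with p | q <;> rcases w with p' | q' <;> simp⟩
  have h2 := treeConnectivity_le_map f (S.map (Equiv.sumComm α β).toEmbedding) (by simpa using hS)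
  have h3 : (S.map (Equiv.sumComm α β).toEmbedding).map f.toEquiv.toEmbedding = S := by
    ext (p | q) <;> simp [f]
  rw [h3] at h2
  exact h1.trans h2

end SimpleGraph

/-! ### Counting edges and outer vertices -/

namespace SimpleGraph

/-- A maximum family of trees is classified by the sides on which a tree leaves `S`: `n₀` trees do
so on both sides, `n₁` on the left only, `n₂` on the right only and `n₃` on neither. The first two
inequalities count outer vertices, the last one counts edges between the two sides of `S`. -/
theorem exists_treeConnectivity_eq_completeBipartiteGraph {α β : Type*} [Fintype α] [Fintype β]
    (S : Finset (α ⊕ β)) (hS : 2 ≤ S.card) {x y : ℕ} (hx : S.toLeft.card = x)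
    (hy : S.toRight.card = y) :
    ∃ n₀ n₁ n₂ n₃ : ℕ,
      (completeBipartiteGraph α β).treeConnectivity S = n₀ + n₁ + n₂ + n₃ ∧
      n₀ + n₁ + x ≤ Fintype.card α ∧ n₀ + n₂ + y ≤ Fintype.card β ∧
      x * n₁ + y * n₂ + (x + y - 1) * n₃ ≤ x * y := by
  classical
  obtain ⟨T, hT⟩ := (isGreatest_treeConnectivity (completeBipartiteGraph α β) S hS).1
  generalize (completeBipartiteGraph α β).treeConnectivity S = ℓ at T hT ⊢
  let A : Fin ℓ → Prop := fun i => ∃ p, Sum.inl p ∈ (T i).verts ∧ Sum.inl p ∉ S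
  let B : Fin ℓ → Prop := fun i => ∃ q, Sum.inr q ∈ (T i).verts ∧ Sum.inr q ∉ S
  let F : Fin ℓ → Finset (α × β) := fun i =>
    (S.toLeft ×ˢ S.toRight).filter (fun z => (T i).Adj (.inl z.1) (.inr z.2))
  have hF : ∀ i p q, Sum.inl p ∈ S → Sum.inr q ∈ S → (T i).Adj (.inl p) (.inr q) →
      (p, q) ∈ F i := fun i p q hp hq h => by simp [F, hp, hq, h]
  have huniq : ∀ i j z, z ∈ (T i).verts → z ∈ (T j).verts → z ∉ S → i = j := by
    intro i j z hi hj hz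
    by_contra hij
    have h : z ∈ (S : Set (α ⊕ β)) := hT.inter_verts i j hij ▸ ⟨hi, hj⟩
    exact hz h
  have hconn : ∀ i, (T i).Connected := fun i => ⟨(hT.isTree i).connected⟩
  have hadj : ∀ i, ∀ z ∈ S, ∃ w, (T i).Adj z w := by
    intro i z hz
    have : Nontrivial (T i).verts := by
      obtain ⟨u, hu, v, hv, huv⟩ := Finset.one_lt_card.mp hS
      exact ⟨⟨u, hT.subset_verts i hu⟩, ⟨v, hT.subset_verts i hv⟩,
        fun h => huv (congrArg Subtype.val h)⟩
    obtain ⟨w, hw⟩ := (hconn i).preconnected.exists_adj_of_nontrivial ⟨z, hT.subset_verts i hz⟩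
    exact ⟨w, hw⟩
  have hsum : ∑ i, (F i).card ≤ x * y := by
    rw [← hx, ← hy, ← Finset.card_product, ← Finset.card_biUnion]
    · exact Finset.card_le_card (Finset.biUnion_subset.2 fun i _ => Finset.filter_subset _ _)
    · intro i _ j _ hij
      rw [Function.onFun, Finset.disjoint_left]
      intro z hz hz'
      exact (Set.disjoint_left.1 (hT.edge_disjoint i j hij))
        (Subgraph.mem_edgeSet.2 (Finset.mem_filter.1 hz).2)
        (Subgraph.mem_edgeSet.2 (Finset.mem_filter.1 hz').2)
  have hnB : ∀ i, ¬ B i → x ≤ (F i).card := by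
    intro i hB
    have : S.toLeft ⊆ (F i).image Prod.fst := by
      intro p hp
      rw [Finset.mem_toLeft] at hp
      obtain ⟨w, hw⟩ := hadj i _ hp
      rcases w with p' | q
      · simpa using (T i).adj_sub hw
      · have hq : Sum.inr q ∈ S := by
          by_contra hq
          exact hB ⟨q, (T i).edge_vert hw.symm, hq⟩
        exact Finset.mem_image.2 ⟨(p, q), hF i p q hp hq hw, rfl⟩
    exact hx ▸ (Finset.card_le_card this).trans Finset.card_image_le
  have hnA : ∀ i, ¬ A i → y ≤ (F i).card := by
    intro i hA
    have : S.toRight ⊆ (F i).image Prod.snd := by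
      intro q hq
      rw [Finset.mem_toRight] at hq
      obtain ⟨w, hw⟩ := hadj i _ hq
      rcases w with p | q'
      · have hp : Sum.inl p ∈ S := by
          by_contra hp
          exact hA ⟨p, (T i).edge_vert hw.symm, hp⟩
        exact Finset.mem_image.2 ⟨(p, q), hF i p q hp hq hw.symm, rfl⟩
      · simpa using (T i).adj_sub hw
    exact hy ▸ (Finset.card_le_card this).trans Finset.card_image_le
  have hnAB : ∀ i, ¬ A i → ¬ B i → x + y - 1 ≤ (F i).card := by
    intro i hA hB
    have hmem : ∀ z, z ∈ (T i).verts → z ∈ S := by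
      rintro (p | q) hz <;> by_contra hzS
      exacts [hA ⟨p, hz, hzS⟩, hB ⟨q, hz, hzS⟩]
    have hv : (T i).verts = S := (hT.subset_verts i).antisymm' hmem
    have h1 := (hconn i).coe.card_vert_le_card_edgeSet_add_one
    have h2 : Nat.card (T i).verts = x + y := by
      rw [hv, ← hx, ← hy, Finset.card_toLeft_add_card_toRight]
      simp
    have h3 : Nat.card (T i).coe.edgeSet = (T i).edgeSet.ncard := by
      rw [← Subgraph.image_coe_edgeSet_coe,
        Set.ncard_image_of_injective _ (Sym2.map.injective Subtype.val_injective)]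
      rfl
    have h4 : (T i).edgeSet ⊆
        ((F i).image (fun z => s(Sum.inl z.1, Sum.inr z.2)) : Finset (Sym2 (α ⊕ β))) := by
      intro e
      induction e with
      | _ u v =>
        intro h
        have h : (T i).Adj u v := h
        have hu := hmem _ ((T i).edge_vert h)
        have hw := hmem _ ((T i).edge_vert h.symm)
        rw [Finset.mem_coe, Finset.mem_image]
        rcases u with p | q <;> rcases v with p' | q'
        · simpa using (T i).adj_sub h
        · exact ⟨(p, q'), hF i p q' hu hw h, rfl⟩
        · exact ⟨(p', q), hF i p' q hw hu h.symm, Sym2.eq_swap⟩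
        · simpa using (T i).adj_sub h
    have h5 := Set.ncard_le_ncard h4
    rw [Set.ncard_coe_finset] at h5
    have h6 := h5.trans Finset.card_image_le
    omega
  have hcA : (∑ i, if A i then 1 else 0) + x ≤ Fintype.card α := by
    rw [← Finset.card_filter, ← hx, ← Finset.card_compl_add_card S.toLeft]
    refine Nat.add_le_add_right ?_ _
    rw [← Fintype.card_subtype, ← Finset.card_univ]
    choose f hf using fun i : {i // A i} => i.2
    refine Finset.card_le_card_of_injOn f (fun i _ => ?_) (fun i _ j _ hij => ?_)
    · simpa using (hf i).2
    · exact Subtype.ext (huniq i j _ (hf i).1 (hij ▸ (hf j).1) (hf i).2)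
  have hcB : (∑ i, if B i then 1 else 0) + y ≤ Fintype.card β := by
    rw [← Finset.card_filter, ← hy, ← Finset.card_compl_add_card S.toRight]
    refine Nat.add_le_add_right ?_ _
    rw [← Fintype.card_subtype, ← Finset.card_univ]
    choose f hf using fun i : {i // B i} => i.2
    refine Finset.card_le_card_of_injOn f (fun i _ => ?_) (fun i _ j _ hij => ?_)
    · simpa using (hf i).2
    · exact Subtype.ext (huniq i j _ (hf i).1 (hij ▸ (hf j).1) (hf i).2)
  refine ⟨∑ i, if A i ∧ B i then 1 else 0, ∑ i, if A i ∧ ¬ B i then 1 else 0,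
    ∑ i, if ¬ A i ∧ B i then 1 else 0, ∑ i, if ¬ A i ∧ ¬ B i then 1 else 0, ?_, ?_, ?_, ?_⟩
  · rw [← Finset.sum_add_distrib, ← Finset.sum_add_distrib, ← Finset.sum_add_distrib]
    trans ∑ _i : Fin ℓ, 1
    · simp
    · refine Finset.sum_congr rfl fun i _ => ?_
      by_cases hA : A i <;> by_cases hB : B i <;> simp [hA, hB]
  · refine le_trans (le_of_eq ?_) hcA
    rw [← Finset.sum_add_distrib]
    refine congrArg (· + x) (Finset.sum_congr rfl fun i _ => ?_)
    by_cases hA : A i <;> by_cases hB : B i <;> simp [hA, hB]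
  · refine le_trans (le_of_eq ?_) hcB
    rw [← Finset.sum_add_distrib]
    refine congrArg (· + y) (Finset.sum_congr rfl fun i _ => ?_)
    by_cases hA : A i <;> by_cases hB : B i <;> simp [hA, hB]
  · refine le_trans ?_ hsum
    rw [Finset.mul_sum, Finset.mul_sum, Finset.mul_sum, ← Finset.sum_add_distrib,
      ← Finset.sum_add_distrib]
    refine Finset.sum_le_sum fun i _ => ?_
    by_cases hA : A i <;> by_cases hB : B i <;> simp [hA, hB]
    · exact hnB i hB
    · exact hnA i hA
    · have := hnAB i hA hB
      omega

/-! ### Optimizing over vertex sets -/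

/-- If `M` is at most the minimum over `z` of `a - z + z (b - a + z) / (k - 1)`, which is the value
of `κ(S)` before rounding when `S` has `z` vertices in the smaller side and `S` leaves out no fewer
vertices on that side than on the other, then `M` is at most `κ(S)` for every `S` of size `k`. -/
theorem le_treeConnectivity_of_forall_int {a b k M : ℕ} (hab : a ≤ b) (hk : 2 ≤ k)
    (hM : ∀ z : ℤ, 0 ≤ z → ((k : ℤ) - 1) * (z + M - a) ≤ z * (z + b - a))
    (S : Finset (Fin a ⊕ Fin b)) (hS : S.card = k) :
    M ≤ (completeBipartiteGraph (Fin a) (Fin b)).treeConnectivity S := by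
  obtain ⟨x, hx⟩ : ∃ x, S.toLeft.card = x := ⟨_, rfl⟩
  obtain ⟨y, hy⟩ : ∃ y, S.toRight.card = y := ⟨_, rfl⟩
  have hxy : x + y = k := by rw [← hx, ← hy, Finset.card_toLeft_add_card_toRight, hS]
  have hxa : x ≤ a := by simpa [hx] using Finset.card_le_univ S.toLeft
  have hyb : y ≤ b := by simpa [hy] using Finset.card_le_univ S.toRight
  have hk1 : ((x + y - 1 : ℕ) : ℤ) = (k : ℤ) - 1 := by omega
  rcases le_or_gt (b + x) (a + y) with h | h
  · -- `S` leaves out at least as many vertices on the left as on the right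
    obtain ⟨n, hn⟩ : ∃ n, n + (b + x) = a + y := ⟨a + y - (b + x), by omega⟩
    have := le_treeConnectivity_completeBipartiteGraph S (by omega) hx hy (n₀ := b - y) (n₁ := n)
      (t := x + M - a) (by simp; omega) (by simp; omega) (by omega) ?_
    · omega
    · rcases le_or_gt (x + M) a with h0 | h0
      · simp [Nat.sub_eq_zero_of_le h0]
      · have h1 := hM x (by omega)
        zify
        rw [hk1, Nat.cast_sub h0.le, Nat.cast_sub (show n ≤ y by omega)]
        have : (y : ℤ) - n = x + b - a := by omega
        rw [this]
        push_cast
        linarith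
  · rcases le_or_gt b (a + y) with h2 | h2
    · obtain ⟨n, hn⟩ : ∃ n, n + (a + y) = b + x := ⟨b + x - (a + y), by omega⟩
      have := le_treeConnectivity_completeBipartiteGraph' S (by omega) hx hy (n₀ := a - x)
        (n₂ := n) (t := y + M - b) (by simp; omega) (by simp; omega) (by omega) ?_
      · omega
      · rcases le_or_gt (y + M) b with h0 | h0
        · simp [Nat.sub_eq_zero_of_le h0]
        · have h1 := hM (y + a - b) (by omega)
          zify
          rw [hk1, Nat.cast_sub h0.le, Nat.cast_sub (show n ≤ x by omega)]
          have : (x : ℤ) - n = y + a - b := by omega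
          rw [this]
          push_cast
          linarith
    · -- enough outer vertices on the right for `a` trees, one for each vertex on the left
      have hMa : M ≤ a := by
        have h1 := hM 0 le_rfl
        have : (M : ℤ) - a ≤ 0 := by
          by_contra hc
          push Not at hc
          have := mul_pos (show (0 : ℤ) < (k : ℤ) - 1 by omega) hc
          linarith
        omega
      have := le_treeConnectivity_completeBipartiteGraph' S (by omega) hx hy (n₀ := a - x)
        (n₂ := x) (t := 0) (by simp; omega) (by simp; omega) le_rfl (by simp)
      omega

/-- `κ(S)` for a set `S` with `x` vertices on the left and `y ≥ 1` on the right is at most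
`a - x + ⌊x (b - a + x) / (k - 1)⌋`, where `k = x + y`; `q` bounds the rounded quotient. -/
theorem treeConnectivity_completeBipartiteGraph_le {a b x y : ℕ} (hy1 : 1 ≤ y) (hk : 2 ≤ x + y)
    (S : Finset (Fin a ⊕ Fin b)) (hx : S.toLeft.card = x) (hy : S.toRight.card = y) {q : ℤ}
    (hq : (x : ℤ) * (x + b - a) < (q + 1) * (x + y - 1)) :
    ((completeBipartiteGraph (Fin a) (Fin b)).treeConnectivity S : ℤ) ≤ a - x + q := by
  have hS : S.card = x + y := by rw [← hx, ← hy, Finset.card_toLeft_add_card_toRight]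
  obtain ⟨n₀, n₁, n₂, n₃, h, h1, h2, h3⟩ :=
    exists_treeConnectivity_eq_completeBipartiteGraph S (by omega) hx hy
  rw [Fintype.card_fin] at h1 h2
  rw [h]
  zify [show 1 ≤ x + y by omega] at h1 h2 h3
  by_contra hc
  push Not at hc
  push_cast at hc
  -- the excess `e` of trees over `a - x` other than those within `S`
  obtain ⟨e, he⟩ : ∃ e : ℤ, e = n₀ + n₁ + n₂ - (a - x) := ⟨_, rfl⟩
  have hn : q + 1 - e ≤ n₃ := by omega
  have h4 : (x + y - 1 : ℤ) * (q + 1 - e) ≤ (x + y - 1) * n₃ :=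
    mul_le_mul_of_nonneg_left hn (by omega)
  have h5 : (x : ℤ) * (e + y) ≤ x * (n₁ + (x + b - a)) :=
    mul_le_mul_of_nonneg_left (by omega) (by omega)
  have h6 : ((y : ℤ) - 1) * e ≤ y * n₂ := by
    rcases le_or_gt e 0 with h0 | h0
    · have : ((y : ℤ) - 1) * e ≤ 0 := mul_nonpos_of_nonneg_of_nonpos (by omega) h0
      exact this.trans (by positivity)
    · exact mul_le_mul (by omega) (by omega) h0.le (by omega)
  linarith

/-- The `k`-connectivity is `a - x + q` if the lower bound for all sets of size `k` and the upper
bound for the sets with `x` vertices on the left meet at this value. -/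
theorem generalizedConnectivity_completeBipartiteGraph_eq {a b k x y : ℕ} {q : ℤ} (hab : a ≤ b)
    (hk : 2 ≤ k) (hy1 : 1 ≤ y) (hxy : x + y = k) (hxa : x ≤ a) (hyb : y ≤ b)
    (hq0 : 0 ≤ q) (hq : (x : ℤ) * (x + b - a) < (q + 1) * (k - 1))
    (hM : ∀ z : ℤ, 0 ≤ z → ((k : ℤ) - 1) * (z - x + q) ≤ z * (z + b - a)) :
    ((completeBipartiteGraph (Fin a) (Fin b)).generalizedConnectivity k : ℤ) = a - x + q := by
  have hleast := isLeast_generalizedConnectivity (completeBipartiteGraph (Fin a) (Fin b)) k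
    (by simp; omega)
  refine le_antisymm ?_ ?_
  · obtain ⟨s, -, hs⟩ := Finset.exists_subset_card_eq (s := (Finset.univ : Finset (Fin a)))
      (by simpa using hxa)
    obtain ⟨t, -, ht⟩ := Finset.exists_subset_card_eq (s := (Finset.univ : Finset (Fin b)))
      (by simpa using hyb)
    have h1 := hleast.2 ⟨s.disjSum t, by rw [Finset.card_disjSum, hs, ht, hxy], rfl⟩
    have h2 := treeConnectivity_completeBipartiteGraph_le (x := x) (q := q) hy1 (by omega)
      (s.disjSum t)
      (by rw [Finset.toLeft_disjSum, hs]) (by rw [Finset.toRight_disjSum, ht])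
      (by rw [← hxy] at hq; push_cast at hq; linarith)
    omega
  · obtain ⟨S, hS, hSeq⟩ := hleast.1
    rw [← hSeq]
    have := le_treeConnectivity_of_forall_int (M := a - x + q.toNat) hab hk ?_ S hS
    · omega
    · intro z hz
      have h1 : ((a - x + q.toNat : ℕ) : ℤ) = a - x + q := by omega
      rw [h1]
      have := hM z hz
      calc ((k : ℤ) - 1) * (z + (a - x + q) - a) = (k - 1) * (z - x + q) := by ring
        _ ≤ _ := this

end SimpleGraph

theorem theorem3p1 (a b k : ℕ) (ha : 1 ≤ a) (hab : a ≤ b) (hk : 2 ≤ k) (hkn : k ≤ a + b) :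
    ((k : ℤ) ≤ (b : ℤ) - a + 2 →
      (completeBipartiteGraph (Fin a) (Fin b)).generalizedConnectivity k = a) ∧
    ((k : ℤ) > (b : ℤ) - a + 2 → Odd ((a : ℤ) - b + k) →
      ((completeBipartiteGraph (Fin a) (Fin b)).generalizedConnectivity k : ℚ) =
        ((a : ℚ) + b - k + 1) / 2 +
          (⌊((a : ℚ) - b + k - 1) * ((b : ℚ) - a + k - 1) / (4 * ((k : ℚ) - 1))⌋ : ℤ)) ∧
    ((k : ℤ) > (b : ℤ) - a + 2 → Even ((a : ℤ) - b + k) →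
      ((completeBipartiteGraph (Fin a) (Fin b)).generalizedConnectivity k : ℚ) =
        ((a : ℚ) + b - k) / 2 +
          (⌊((a : ℚ) - b + k) * ((b : ℚ) - a + k) / (4 * ((k : ℚ) - 1))⌋ : ℤ)) := by
  -- the minimum is attained at an `x` next to the vertex `(k - 1 + a - b) / 2` of the parabola
  have main : ∀ x : ℕ, x ≤ a → k ≤ x + b → x < k → a ≤ b + x →
      (2 * (x : ℤ) = k - 1 + a - b ∨ 2 * (x : ℤ) = k + a - b) →
      ((completeBipartiteGraph (Fin a) (Fin b)).generalizedConnectivity k : ℚ) =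
        (a : ℚ) - x + (⌊(x : ℚ) * (x + b - a) / (k - 1)⌋ : ℤ) := by
    intro x h1 h2 h3 h4 h5
    set q : ℤ := ⌊(x : ℚ) * (x + b - a) / (k - 1)⌋ with hq
    have hk1 : (0 : ℚ) < k - 1 := by
      have : (2 : ℚ) ≤ k := by exact_mod_cast hk
      linarith
    have hx0 : (0 : ℚ) ≤ x + b - a := by
      have : (a : ℚ) ≤ b + x := by exact_mod_cast h4
      linarith
    have hlo : q * ((k : ℤ) - 1) ≤ x * (x + b - a) := by
      have := (le_div_iff₀ hk1).1 (Int.floor_le ((x : ℚ) * (x + b - a) / (k - 1)))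
      rw [← hq] at this
      exact_mod_cast this
    have hhi : (x : ℤ) * (x + b - a) < (q + 1) * (k - 1) := by
      have := (div_lt_iff₀ hk1).1 (Int.lt_floor_add_one ((x : ℚ) * (x + b - a) / (k - 1)))
      rw [← hq] at this
      exact_mod_cast this
    have := SimpleGraph.generalizedConnectivity_completeBipartiteGraph_eq (a := a) (b := b)
      (k := k) (x := x) (y := k - x) (q := q) hab hk (by omega) (by omega) h1 (by omega)
      (Int.floor_nonneg.2 (by positivity)) hhi ?_
    · exact_mod_cast this
    · intro z _
      -- `(z - x) (z + x - (k - 1 + a - b)) ≥ 0`, the second factor being `z - x` or `z - x + 1`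
      have hz : 0 ≤ (z - x) * (z + x - (k - 1 + a - b)) := by
        rcases h5 with h5 | h5
        · rw [show z + x - (k - 1 + a - b) = z - x by omega]
          exact mul_self_nonneg _
        · rw [show z + x - (k - 1 + a - b) = z - x + 1 by omega]
          rcases le_or_gt 0 (z - x) with h | h
          · exact mul_nonneg h (by omega)
          · exact mul_nonneg_of_nonpos_of_nonpos h.le (by omega)
      linarith
  refine ⟨fun h => ?_, fun h ho => ?_, fun h he => ?_⟩
  · have hz : ∀ z : ℤ, 0 ≤ z → ((k : ℤ) - 1) * z ≤ z * (z + b - a) := by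
      intro z hz
      rcases hz.eq_or_lt with rfl | hz
      · simp
      · rw [mul_comm]
        exact mul_le_mul_of_nonneg_left (by omega) hz.le
    rcases le_or_gt k b with hkb | hkb
    · have := SimpleGraph.generalizedConnectivity_completeBipartiteGraph_eq (a := a) (b := b)
        (k := k) (x := 0) (y := k) (q := 0) hab hk (by omega) (by omega) (by omega) hkb le_rfl
        (by simp; omega) (by simpa using hz)
      simpa using this
    · -- here `a = 1` and `S` consists of all vertices
      have := SimpleGraph.generalizedConnectivity_completeBipartiteGraph_eq (a := a) (b := b)
        (k := k) (x := 1) (y := b) (q := 1) hab hk (by omega) (by omega) (by omega) le_rfl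
        (by omega) (by push_cast; linarith) (by simpa using hz)
      simpa using this
  · obtain ⟨m, hm⟩ := ho
    have h1 := main m.toNat (by omega) (by omega) (by omega) (by omega) (by omega)
    have hmq : ((m.toNat : ℕ) : ℚ) = (a - b + k - 1) / 2 := by
      have h2 : (2 * m.toNat : ℤ) = a - b + k - 1 := by omega
      have h3 : (2 * m.toNat : ℚ) = a - b + k - 1 := by exact_mod_cast h2
      linarith
    rw [h1, hmq]
    congr 1
    · ring
    · congr 2
      rw [← mul_div_mul_left _ ((k : ℚ) - 1) (four_ne_zero)]
      congr 1
      ring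
  · obtain ⟨m, hm⟩ := he
    have h1 := main m.toNat (by omega) (by omega) (by omega) (by omega) (by omega)
    have hmq : ((m.toNat : ℕ) : ℚ) = (a - b + k) / 2 := by
      have h2 : (2 * m.toNat : ℤ) = a - b + k := by omega
      have h3 : (2 * m.toNat : ℚ) = a - b + k := by exact_mod_cast h2
      linarith
    rw [h1, hmq]
    congr 1
    · ring
    · congr 2
      rw [← mul_div_mul_left _ ((k : ℚ) - 1) (four_ne_zero)]
      congr 1
      ring
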